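/- Let $N$ be a smooth Riemannian manifold. A non-constant smooth function $f:N\to\mathbb{R}$ is called transnormal if $|\nabla f|^2=b(f)$ for some smooth function $b:\mathbb{R}\to\mathbb{R}$, and isoparametric if moreover $\Delta f=a(f)$ for some continuous function $a:\mathbb{R}\to\mathbb{R}$, where $\nabla f$ is the gradient and $\Delta f$ the Laplacian (the trace of the Hessian) of $f$. The focal varieties of a transnormal function $f$ form the set $\{p\in N:\nabla f(p)=0\}$; an isoparametric function is called properly isoparametric if this set is, near each of its points, a smooth embedded submanifold of codimension at least $2$ (the codimension may differ from one connected component to another). Let $E$ and $B$ be smooth Riemannian manifolds, and let $\pi:E\to B$ be a Riemannian submersion, that is, a smooth surjective map such that each differential $d\pi_p:T_pE\to T_{\pi(p)}B$ is surjective and is isometric on the orthogonal complement of $\ker d\pi_p$. Suppose that the fibres of $\pi$ are minimal, that is, the trace of the second fundamental form of each fibre vanishes at every point of the fibre. If $f:B\to\mathbb{R}$ is isoparametric, then $f\circ\pi:E\to\mathbb{R}$ is isoparametric; and if $f$ is properly isoparametric, then $f\circ\pi$ is properly isoparametric. -/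

import Mathlib

open Bundle Set
open scoped Manifold ContDiff Topology

noncomputable section

namespace RiemGeom

section Metric

variable (n : ℕ) {M : Type*} [TopologicalSpace M] [ChartedSpace (EuclideanSpace ℝ (Fin n)) M]

instance (p : M) : FiniteDimensional ℝ (TangentSpace (𝓡 n) p) :=
  inferInstanceAs (FiniteDimensional ℝ (EuclideanSpace ℝ (Fin n)))

variable [IsManifold (𝓡 n) ∞ M]

/-- The components, with respect to the coordinate vector fields of the preferred chart at `p`, of
tangent vectors at `q` (for `q` in the domain of that chart). This is the differential at `q` of
the chart at `p`. -/
def toCoord (p q : M) : TangentSpace (𝓡 n) q →L[ℝ] EuclideanSpace ℝ (Fin n) :=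
  (trivializationAt (EuclideanSpace ℝ (Fin n)) (TangentSpace (𝓡 n) : M → Type _)
    p).continuousLinearMapAt ℝ q

/-- The tangent vector at `q` with given components with respect to the coordinate vector fields
of the preferred chart at `p`; inverse of `toCoord n p q`. Thus `q ↦ ofCoord n p q u` is the
coordinate vector field of the chart at `p` in the constant direction `u`. -/
def ofCoord (p q : M) : EuclideanSpace ℝ (Fin n) →L[ℝ] TangentSpace (𝓡 n) q :=
  (trivializationAt (EuclideanSpace ℝ (Fin n)) (TangentSpace (𝓡 n) : M → Type _)
    p).symmL ℝ q

variable [RiemannianBundle (fun x : M ↦ TangentSpace (𝓡 n) x)]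

instance (p : M) : CompleteSpace (TangentSpace (𝓡 n) p) := FiniteDimensional.complete ℝ _

/-- The Riemannian metric in the chart at `p`: `chartMetric n p y u v = g_{ij}(y) uⁱ vʲ`. -/
def chartMetric (p : M) (y : EuclideanSpace ℝ (Fin n)) :
    EuclideanSpace ℝ (Fin n) →L[ℝ] EuclideanSpace ℝ (Fin n) →L[ℝ] ℝ :=
  (innerSL ℝ (E := TangentSpace (𝓡 n) ((extChartAt (𝓡 n) p).symm y))).bilinearComp
    (ofCoord n p _) (ofCoord n p _)

/-- The Christoffel symbols of the first kind at `p`, in the chart at `p`, as a linear form in `w`: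
`christoffelForm n p u v w = (∂_u g(v,w) + ∂_v g(u,w) - ∂_w g(u,v)) / 2`. -/
def christoffelForm (p : M) (u v : EuclideanSpace ℝ (Fin n)) :
    EuclideanSpace ℝ (Fin n) →L[ℝ] ℝ :=
  let dg := fderiv ℝ (chartMetric n p) (extChartAt (𝓡 n) p p)
  (1 / 2 : ℝ) • (dg u v + dg v u - (dg.flip u).flip v)

/-- The Levi-Civita covariant derivative `∇_u ∂_v` at `p` of the coordinate vector field `∂_v` of
the chart at `p` (Christoffel symbols of the second kind, as a tangent vector). -/
def christoffel (p : M) (u v : EuclideanSpace ℝ (Fin n)) : TangentSpace (𝓡 n) p :=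
  (InnerProductSpace.toDual ℝ (TangentSpace (𝓡 n) p)).symm
    ((christoffelForm n p u v).comp (toCoord n p p))

/-- The Levi-Civita covariant derivative `∇_v W` at `p`, for a tangent vector `v` at `p` and a
vector field `W` defined near `p`: in components, `vⁱ (∂ᵢ Wᵏ + Γᵏᵢⱼ Wʲ)`. -/
def covDeriv (p : M) (v : TangentSpace (𝓡 n) p) (W : ∀ q : M, TangentSpace (𝓡 n) q) :
    TangentSpace (𝓡 n) p :=
  ofCoord n p p (fderiv ℝ
      (fun y ↦ toCoord n p ((extChartAt (𝓡 n) p).symm y) (W ((extChartAt (𝓡 n) p).symm y)))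
      (extChartAt (𝓡 n) p p) (toCoord n p p v))
    + christoffel n p (toCoord n p p v) (toCoord n p p (W p))

/-- The gradient of a function. -/
def grad (f : M → ℝ) (p : M) : TangentSpace (𝓡 n) p :=
  (InnerProductSpace.toDual ℝ (TangentSpace (𝓡 n) p)).symm (mvfderiv (𝓡 n) f p)

/-- The Hessian `H_f(v,w) = v(W f) - (∇_v W) f`, evaluated with the extension `W` of `w` that is
constant in the chart at `p`: in components, `(∂ᵢ∂ⱼ f - Γᵏᵢⱼ ∂ₖ f) vⁱ wʲ`. -/
def hessian (f : M → ℝ) (p : M) (v w : TangentSpace (𝓡 n) p) : ℝ :=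
  fderiv ℝ (fderiv ℝ (f ∘ (extChartAt (𝓡 n) p).symm)) (extChartAt (𝓡 n) p p)
      (toCoord n p p v) (toCoord n p p w)
    - mvfderiv (𝓡 n) f p (christoffel n p (toCoord n p p v) (toCoord n p p w))

/-- The Laplacian (Laplace-Beltrami operator), the trace of the Hessian. -/
def laplacian (f : M → ℝ) (p : M) : ℝ :=
  ∑ i, hessian n f p (stdOrthonormalBasis ℝ (TangentSpace (𝓡 n) p) i)
    (stdOrthonormalBasis ℝ (TangentSpace (𝓡 n) p) i)

/-- `f` is non-constant and smooth, and `|∇f|² = b(f)` for the smooth function `b`. -/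
structure IsTransnormalWith (f : M → ℝ) (b : ℝ → ℝ) : Prop where
  smooth : ContMDiff (𝓡 n) 𝓘(ℝ, ℝ) ∞ f
  nonconstant : ∃ p q, f p ≠ f q
  smooth_b : ContDiff ℝ ∞ b
  norm_grad : ∀ p, ‖grad n f p‖ ^ 2 = b (f p)

/-- Isoparametric functions: transnormal functions with `Δf = a(f)` for a continuous `a`. -/
def IsIsoparametric (f : M → ℝ) : Prop :=
  (∃ b : ℝ → ℝ, IsTransnormalWith n f b) ∧
    ∃ a : ℝ → ℝ, Continuous a ∧ ∀ p, laplacian n f p = a (f p)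

/-- The focal varieties of a transnormal function: the set where the gradient vanishes (on a
connected manifold, this is where `f` attains its maximum or its minimum). -/
def focalVarieties (f : M → ℝ) : Set M := {p | grad n f p = 0}

/-- `C` is, near each of its points, an embedded smooth submanifold of codimension at least `2`
(the codimension `k` may vary from one component of `C` to another). -/
def IsSubmanifoldCodimGeTwo (C : Set M) : Prop :=
  ∀ p ∈ C, ∃ k : ℕ, 2 ≤ k ∧ ∃ U : Set M, IsOpen U ∧ p ∈ U ∧
    ∃ g : M → EuclideanSpace ℝ (Fin k), ContMDiffOn (𝓡 n) 𝓘(ℝ, EuclideanSpace ℝ (Fin k)) ∞ g U ∧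
      (∀ q ∈ U, Function.Surjective (mfderiv (𝓡 n) 𝓘(ℝ, EuclideanSpace ℝ (Fin k)) g q)) ∧
      C ∩ U = {q ∈ U | g q = 0}

/-- Properly isoparametric functions: the focal varieties have codimension at least `2`. -/
def IsProperlyIsoparametric (f : M → ℝ) : Prop :=
  IsIsoparametric n f ∧ IsSubmanifoldCodimGeTwo n (focalVarieties n f)

end Metric

section Submersion

variable (m n : ℕ)
  {E : Type*} [TopologicalSpace E] [ChartedSpace (EuclideanSpace ℝ (Fin m)) E]
  [IsManifold (𝓡 m) ∞ E] [RiemannianBundle (fun x : E ↦ TangentSpace (𝓡 m) x)]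
  {B : Type*} [TopologicalSpace B] [ChartedSpace (EuclideanSpace ℝ (Fin n)) B]

/-- The vertical space at `p`: the tangent space at `p` of the fibre of `pr` through `p`. -/
def vertical (pr : E → B) (p : E) : Submodule ℝ (TangentSpace (𝓡 m) p) :=
  LinearMap.ker (mfderiv (𝓡 m) (𝓡 n) pr p).toLinearMap

/-- Riemannian submersions: smooth maps onto `B` whose differentials are onto and are isometric on
the horizontal spaces (the orthogonal complements of the vertical spaces). -/
structure IsRiemannianSubmersion [RiemannianBundle (fun x : B ↦ TangentSpace (𝓡 n) x)]
    (pr : E → B) : Prop where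
  smooth : ContMDiff (𝓡 m) (𝓡 n) ∞ pr
  surjective : Function.Surjective pr
  surjective_mfderiv : ∀ p, Function.Surjective (mfderiv (𝓡 m) (𝓡 n) pr p)
  isometric : ∀ p, ∀ v ∈ (vertical m n pr p)ᗮ, ‖mfderiv (𝓡 m) (𝓡 n) pr p v‖ = ‖v‖

/-- `W` is smooth on an open neighbourhood of `p`, and vertical there: it is tangent to the fibres
of `pr`. -/
def IsVerticalFieldNear (pr : E → B) (p : E) (W : ∀ q : E, TangentSpace (𝓡 m) q) : Prop :=
  ∃ U : Set E, IsOpen U ∧ p ∈ U ∧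
    ContMDiffOn (𝓡 m) (𝓡 m).tangent ∞
      (fun q ↦ (TotalSpace.mk' (EuclideanSpace ℝ (Fin m)) q (W q) : TangentBundle (𝓡 m) E)) U ∧
    ∀ q ∈ U, W q ∈ vertical m n pr q

/-- The second fundamental form `II(v, W p)` at `p` of the fibre through `p`: the normal component
of `∇_v W`, for `v` tangent to the fibre and `W` a vector field tangent to the fibres near `p`. -/
def fibreSecondForm (pr : E → B) (p : E) (v : TangentSpace (𝓡 m) p)
    (W : ∀ q : E, TangentSpace (𝓡 m) q) : TangentSpace (𝓡 m) p :=
  (vertical m n pr p)ᗮ.starProjection (covDeriv m p v W)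

/-- The fibres of `pr` are minimal: at each point `p`, the trace of the second fundamental form of
the fibre, computed in any orthonormal basis `e` of its tangent space and with any extensions of
the `e i` to vector fields tangent to the fibres, is zero. -/
def HasMinimalFibres (pr : E → B) : Prop :=
  ∀ (p : E) (k : ℕ) (e : OrthonormalBasis (Fin k) ℝ (vertical m n pr p))
    (W : Fin k → ∀ q : E, TangentSpace (𝓡 m) q),
    (∀ i, IsVerticalFieldNear m n pr p (W i)) → (∀ i, W i p = e i) →
    ∑ i, fibreSecondForm m n pr p (e i) (W i) = 0

end Submersion

end RiemGeom

end

/-! The gradient of `f ∘ pr` is the horizontal lift of that of `f`, and its Laplacian at `p` is that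
of `f` at `pr p`, so the same `b` and `a` serve upstairs. The Laplacian is the trace of the Hessian
over an orthonormal basis adapted to vertical ⊕ horizontal.

Horizontal part (`hessian_comp_horizontal`): the metric of `E` dominates the pullback of that of
`B`, with equality at `p` on horizontal vectors. For a fixed coordinate vector that is horizontal at
`p`, the difference is therefore minimal at `p` and its first derivatives vanish. Hence the two
Christoffel forms agree on horizontal vectors (`christoffel_pullback`, `mfderiv_christoffel`), and
no horizontal vector fields are needed.

Vertical part (`HasMinimalFibres.sum_hessian_comp_vertical`): `f ∘ pr` is constant on fibres, so its
Hessian there is minus its differential applied to the second fundamental form, whose trace is zero.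

The focal set upstairs is the preimage of the one downstairs, and a submersion pulls submanifolds
back with the same codimension. -/

open Bundle Set
open scoped Manifold ContDiff Topology

noncomputable section

namespace RiemGeom

/-! ### Tangent vectors, derivatives and the metric in charts -/

section Chart

variable {n : ℕ} {M : Type*} [TopologicalSpace M] [ChartedSpace (EuclideanSpace ℝ (Fin n)) M]

theorem mvfderiv_comp_apply {m : ℕ} {N : Type*} [TopologicalSpace N]
    [ChartedSpace (EuclideanSpace ℝ (Fin m)) N]
    {F : Type*} [NormedAddCommGroup F] [NormedSpace ℝ F] {g : M → F} {h : N → M} {p : N}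
    (hg : MDifferentiableAt (𝓡 n) 𝓘(ℝ, F) g (h p)) (hh : MDifferentiableAt (𝓡 m) (𝓡 n) h p)
    (v : TangentSpace (𝓡 m) p) :
    mvfderiv (𝓡 m) (g ∘ h) p v = mvfderiv (𝓡 n) g (h p) (mfderiv (𝓡 m) (𝓡 n) h p v) := by
  simp only [mvfderiv]
  rw [mfderiv_comp p hg hh]
  rfl

variable [IsManifold (𝓡 n) ∞ M]

theorem toCoord_ofCoord {p q : M} (hq : q ∈ (extChartAt (𝓡 n) p).source)
    (u : EuclideanSpace ℝ (Fin n)) : toCoord n p q (ofCoord n p q u) = u :=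
  Bundle.Trivialization.continuousLinearMapAt_symmL _
    (by simpa [extChartAt_source] using hq) u

theorem ofCoord_toCoord {p q : M} (hq : q ∈ (extChartAt (𝓡 n) p).source)
    (v : TangentSpace (𝓡 n) q) : ofCoord n p q (toCoord n p q v) = v :=
  Bundle.Trivialization.symmL_continuousLinearMapAt _
    (by simpa [extChartAt_source] using hq) v

theorem toCoord_eq_mvfderiv {p q : M} (hq : q ∈ (extChartAt (𝓡 n) p).source) :
    toCoord n p q = mvfderiv (𝓡 n) (extChartAt (𝓡 n) p) q := by
  have : IsManifold (𝓡 n) 1 M := IsManifold.of_le (n := ∞) (by simp)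
  have h := TangentBundle.continuousLinearMapAt_trivializationAt (I := 𝓡 n) (x₀ := p) (x := q)
    (by simpa [extChartAt_source] using hq)
  ext1 v
  exact DFunLike.congr_fun h v

variable {F : Type*} [NormedAddCommGroup F] [NormedSpace ℝ F]

theorem contDiffAt_comp_extChartAt_symm {g : M → F} {p q : M}
    (hq : q ∈ (extChartAt (𝓡 n) p).source) (hg : ContMDiffAt (𝓡 n) 𝓘(ℝ, F) ∞ g q) :
    ContDiffAt ℝ ∞ (g ∘ (extChartAt (𝓡 n) p).symm) (extChartAt (𝓡 n) p q) := by
  rw [← contMDiffAt_iff_contDiffAt]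
  have h := (contMDiffOn_extChartAt_symm (I := 𝓡 n) (n := ∞) p).contMDiffAt
    (extChartAt_target_mem_nhds' ((extChartAt (𝓡 n) p).map_source hq))
  refine ContMDiffAt.comp _ ?_ h
  rwa [(extChartAt (𝓡 n) p).left_inv hq]

theorem fderiv_comp_extChartAt_symm {g : M → F} {p q : M}
    (hq : q ∈ (extChartAt (𝓡 n) p).source) (hg : ContMDiffAt (𝓡 n) 𝓘(ℝ, F) ∞ g q)
    (v : TangentSpace (𝓡 n) q) :
    fderiv ℝ (g ∘ (extChartAt (𝓡 n) p).symm) (extChartAt (𝓡 n) p q) (toCoord n p q v) =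
      mvfderiv (𝓡 n) g q v := by
  have : IsManifold (𝓡 n) 1 M := IsManifold.of_le (n := ∞) (by simp)
  have hd := (contDiffAt_comp_extChartAt_symm hq hg).differentiableAt (by simp)
  have hφ : MDifferentiableAt (𝓡 n) 𝓘(ℝ, EuclideanSpace ℝ (Fin n)) (extChartAt (𝓡 n) p) q :=
    mdifferentiableAt_extChartAt (by simpa [extChartAt_source] using hq)
  have heq : g =ᶠ[𝓝 q] (g ∘ (extChartAt (𝓡 n) p).symm) ∘ extChartAt (𝓡 n) p := by
    filter_upwards [extChartAt_source_mem_nhds' hq] with x hx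
    rw [Function.comp_apply, Function.comp_apply, (extChartAt (𝓡 n) p).left_inv hx]
  rw [toCoord_eq_mvfderiv hq]
  simp only [mvfderiv]
  rw [heq.mfderiv_eq, mfderiv_comp q hd.mdifferentiableAt hφ, mfderiv_eq_fderiv]
  rfl

theorem contMDiffAt_ofCoord {p q : M} (hq : q ∈ (extChartAt (𝓡 n) p).source)
    {w : M → EuclideanSpace ℝ (Fin n)}
    (hw : ContMDiffAt (𝓡 n) 𝓘(ℝ, EuclideanSpace ℝ (Fin n)) ∞ w q) :
    ContMDiffAt (𝓡 n) (𝓡 n).tangent ∞ (fun x ↦ (TotalSpace.mk' (EuclideanSpace ℝ (Fin n)) x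
      (ofCoord n p x (w x)) : TangentBundle (𝓡 n) M)) q := by
  have hb : q ∈ (trivializationAt (EuclideanSpace ℝ (Fin n))
      (TangentSpace (𝓡 n) : M → Type _) p).baseSet := by simpa [extChartAt_source] using hq
  refine (Bundle.Trivialization.contMDiffAt_section_iff (trivializationAt
    (EuclideanSpace ℝ (Fin n)) (TangentSpace (𝓡 n) : M → Type _) p) hb).2 ?_
  refine hw.congr_of_eventuallyEq ?_
  filter_upwards [extChartAt_source_mem_nhds' hq] with x hx
  have h := toCoord_ofCoord hx (w x)
  rwa [toCoord, Bundle.Trivialization.continuousLinearMapAt_apply,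
    Bundle.Trivialization.coe_linearMapAt_of_mem _
    (by simpa [extChartAt_source] using hx)] at h

variable [RiemannianBundle (fun x : M ↦ TangentSpace (𝓡 n) x)]

omit [IsManifold (𝓡 n) ∞ M] in
theorem inner_grad (f : M → ℝ) (p : M) (v : TangentSpace (𝓡 n) p) :
    inner ℝ (grad n f p) v = mvfderiv (𝓡 n) f p v := by
  simp [grad]

theorem inner_christoffel (p : M) (u v : EuclideanSpace ℝ (Fin n)) (w : TangentSpace (𝓡 n) p) :
    inner ℝ (christoffel n p u v) w = christoffelForm n p u v (toCoord n p p w) := by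
  simp [christoffel]

theorem christoffelForm_apply (p : M) (u v w : EuclideanSpace ℝ (Fin n)) :
    christoffelForm n p u v w =
      (1 / 2) * (fderiv ℝ (chartMetric n p) (extChartAt (𝓡 n) p p) u v w +
        fderiv ℝ (chartMetric n p) (extChartAt (𝓡 n) p p) v u w -
        fderiv ℝ (chartMetric n p) (extChartAt (𝓡 n) p p) w u v) := by
  simp [christoffelForm]

theorem christoffelForm_self (p : M) (u w : EuclideanSpace ℝ (Fin n)) :
    christoffelForm n p u u w =
      fderiv ℝ (chartMetric n p) (extChartAt (𝓡 n) p p) u u w -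
        (1 / 2) * fderiv ℝ (chartMetric n p) (extChartAt (𝓡 n) p p) w u u := by
  rw [christoffelForm_apply]
  ring

theorem chartMetric_symm (p : M) (y u v : EuclideanSpace ℝ (Fin n)) :
    chartMetric n p y u v = chartMetric n p y v u := by
  simp only [chartMetric, ContinuousLinearMap.bilinearComp_apply, innerSL_apply_apply]
  exact real_inner_comm _ _

theorem chartMetric_extChartAt {p q : M} (hq : q ∈ (extChartAt (𝓡 n) p).source)
    (u v : EuclideanSpace ℝ (Fin n)) :
    chartMetric n p (extChartAt (𝓡 n) p q) u v =
      inner ℝ (ofCoord n p q u) (ofCoord n p q v) := by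
  -- Returning from the chart gives `q` only up to a propositional equality, and the tangent spaces
  -- are indexed by the point; hence the base point is generalised before substitution.
  have key : ∀ q', q' = q → inner ℝ (ofCoord n p q' u) (ofCoord n p q' v) =
      inner ℝ (ofCoord n p q u) (ofCoord n p q v) := by
    rintro _ rfl; rfl
  simp only [chartMetric, ContinuousLinearMap.bilinearComp_apply, innerSL_apply_apply]
  exact key _ ((extChartAt (𝓡 n) p).left_inv hq)

theorem differentiableAt_chartMetric [IsContMDiffRiemannianBundle (𝓡 n) ∞
      (EuclideanSpace ℝ (Fin n)) (fun x : M ↦ TangentSpace (𝓡 n) x)] (p : M) :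
    DifferentiableAt ℝ (chartMetric n p) (extChartAt (𝓡 n) p p) := by
  have h : ContDiffOn ℝ 1 (chartMetric n p) (extChartAt (𝓡 n) p).target := by
    -- In finite dimension, smoothness of a field of bilinear forms is tested on pairs of constant
    -- vectors, that is, on inner products of coordinate fields.
    rw [contDiffOn_clm_apply]
    intro u
    rw [contDiffOn_clm_apply]
    intro v y hy
    have hq := (extChartAt (𝓡 n) p).map_target hy
    have hu := contMDiffAt_ofCoord hq (w := fun _ ↦ u) contMDiffAt_const
    have hv := contMDiffAt_ofCoord hq (w := fun _ ↦ v) contMDiffAt_const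
    have h := contDiffAt_comp_extChartAt_symm hq (ContMDiffAt.inner_bundle hu hv)
    rw [(extChartAt (𝓡 n) p).right_inv hy] at h
    exact (h.of_le (by simp)).contDiffWithinAt
  exact ((h.contDiffAt (extChartAt_target_mem_nhds p)).differentiableAt (by simp))

end Chart

/-! ### Traces of bilinear forms -/

section Linear

/-- Both sides expand to the double sum of `⟪e' j, e i⟫ * β (e i) (e' j)`; symmetry of `β` plays no
role. -/
theorem sum_bilin_orthonormalBasis_eq {V : Type*} [NormedAddCommGroup V] [InnerProductSpace ℝ V]
    {ι κ : Type*} [Fintype ι] [Fintype κ] (β : V →ₗ[ℝ] V →ₗ[ℝ] ℝ)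
    (e : OrthonormalBasis ι ℝ V) (e' : OrthonormalBasis κ ℝ V) :
    ∑ i, β (e i) (e i) = ∑ j, β (e' j) (e' j) := by
  have h1 : ∀ i, β (e i) (e i) = ∑ j, inner ℝ (e' j) (e i) * β (e i) (e' j) := fun i ↦ by
    conv_lhs => rw [← e'.sum_repr' (e i)]
    rw [e'.sum_repr']
    conv_lhs => arg 2; rw [← e'.sum_repr' (e i)]
    simp
  have h2 : ∀ j, β (e' j) (e' j) = ∑ i, inner ℝ (e' j) (e i) * β (e i) (e' j) := fun j ↦ by
    conv_lhs => arg 1; rw [← e.sum_repr' (e' j)]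
    simp [real_inner_comm]
  simp_rw [h1, h2]
  exact Finset.sum_comm

theorem sum_bilin_eq_add_orthogonal {V : Type*} [NormedAddCommGroup V] [InnerProductSpace ℝ V]
    {ι κ μ : Type*} [Fintype ι] [Fintype κ] [Fintype μ] (β : V →ₗ[ℝ] V →ₗ[ℝ] ℝ)
    (K : Submodule ℝ V) [K.HasOrthogonalProjection] (e : OrthonormalBasis ι ℝ V)
    (a : OrthonormalBasis κ ℝ K) (b : OrthonormalBasis μ ℝ Kᗮ) :
    ∑ i, β (e i) (e i) = ∑ j, β (a j) (a j) + ∑ j, β (b j) (b j) := by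
  rw [sum_bilin_orthonormalBasis_eq β e ((a.prod b).map K.orthogonalDecomposition.symm)]
  simp [Fintype.sum_sum_type]

end Linear

/-! ### Second-order chain rule and the Christoffel form of a pullback -/

section Calculus

variable {X Y : Type*} [NormedAddCommGroup X] [NormedSpace ℝ X]
  [NormedAddCommGroup Y] [NormedSpace ℝ Y]

theorem fderiv_fderiv_comp {F : Type*} [NormedAddCommGroup F] [NormedSpace ℝ F]
    {g : Y → F} {φ : X → Y} {x : X} (hg : ContDiffAt ℝ 2 g (φ x)) (hφ : ContDiffAt ℝ 2 φ x)
    (u v : X) :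
    fderiv ℝ (fderiv ℝ (g ∘ φ)) x u v =
      fderiv ℝ (fderiv ℝ g) (φ x) (fderiv ℝ φ x u) (fderiv ℝ φ x v) +
        fderiv ℝ g (φ x) (fderiv ℝ (fderiv ℝ φ) x u v) := by
  have h1 : fderiv ℝ (g ∘ φ) =ᶠ[𝓝 x] fun y ↦ (fderiv ℝ g (φ y)).comp (fderiv ℝ φ y) := by
    filter_upwards [hφ.continuousAt.eventually (hg.eventually (by simp)),
      hφ.eventually (by simp)] with y hy hy'
    exact fderiv_comp y (hy.differentiableAt (by simp)) (hy'.differentiableAt (by simp))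
  have hd : DifferentiableAt ℝ φ x := hφ.differentiableAt (by simp)
  have hg' : DifferentiableAt ℝ (fderiv ℝ g) (φ x) :=
    (hg.fderiv_right (m := 1) (by norm_num)).differentiableAt (by simp)
  have hφ' : DifferentiableAt ℝ (fderiv ℝ φ) x :=
    (hφ.fderiv_right (m := 1) (by norm_num)).differentiableAt (by simp)
  have hgφ : HasFDerivAt (fun y ↦ fderiv ℝ g (φ y)) _ x :=
    hg'.hasFDerivAt.comp x hd.hasFDerivAt
  rw [h1.fderiv_eq, (hgφ.clm_comp hφ'.hasFDerivAt).fderiv]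
  simp [add_comm]

set_option synthInstance.maxHeartbeats 200000 in
/-- The derivative of the pullback by `φ` of a field `H` of bilinear forms. -/
theorem hasFDerivAt_pullback {H : Y → Y →L[ℝ] Y →L[ℝ] ℝ} {φ : X → Y} {x : X}
    (hH : DifferentiableAt ℝ H (φ x)) (hφ : ContDiffAt ℝ 2 φ x) (w : X) :
    ∃ L : X →L[ℝ] ℝ, HasFDerivAt (fun y ↦ H (φ y) (fderiv ℝ φ y w) (fderiv ℝ φ y w)) L x ∧
      ∀ u, L u = fderiv ℝ H (φ x) (fderiv ℝ φ x u) (fderiv ℝ φ x w) (fderiv ℝ φ x w) +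
        H (φ x) (fderiv ℝ (fderiv ℝ φ) x u w) (fderiv ℝ φ x w) +
        H (φ x) (fderiv ℝ φ x w) (fderiv ℝ (fderiv ℝ φ) x u w) := by
  have hd := (hφ.differentiableAt (by simp)).hasFDerivAt
  have hφ' : DifferentiableAt ℝ (fderiv ℝ φ) x :=
    (hφ.fderiv_right (m := 1) (by norm_num)).differentiableAt (by simp)
  have hw := hφ'.hasFDerivAt.clm_apply (hasFDerivAt_const w x)
  have hHφ : HasFDerivAt (fun y ↦ H (φ y)) ((fderiv ℝ H (φ x)).comp (fderiv ℝ φ x)) x :=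
    HasFDerivAt.comp (g := H) x hH.hasFDerivAt hd
  refine ⟨_, (hHφ.clm_apply hw).clm_apply hw, fun u ↦ ?_⟩
  simp
  ring

/-- If a field `G` of symmetric bilinear forms dominates the pullback of `H` by `φ`, with
equality at `x` on a subspace `S`, then on `S` the Christoffel form of `G` at `x` is the one of
the pullback. -/
theorem christoffel_pullback {G : X → X →L[ℝ] X →L[ℝ] ℝ} {H : Y → Y →L[ℝ] Y →L[ℝ] ℝ}
    {φ : X → Y} {x : X} (hG : DifferentiableAt ℝ G x) (hH : DifferentiableAt ℝ H (φ x))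
    (hφ : ContDiffAt ℝ 2 φ x) (hGs : ∀ y u v, G y u v = G y v u)
    (hHs : ∀ y u v, H y u v = H y v u)
    (hle : ∀ᶠ y in 𝓝 x, ∀ u, H (φ y) (fderiv ℝ φ y u) (fderiv ℝ φ y u) ≤ G y u u)
    (S : Submodule ℝ X)
    (heq : ∀ u ∈ S, H (φ x) (fderiv ℝ φ x u) (fderiv ℝ φ x u) = G x u u)
    {a z : X} (ha : a ∈ S) (hz : z ∈ S) :
    fderiv ℝ G x a a z - (1 / 2) * fderiv ℝ G x z a a =
      fderiv ℝ H (φ x) (fderiv ℝ φ x a) (fderiv ℝ φ x a) (fderiv ℝ φ x z) -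
        (1 / 2) * fderiv ℝ H (φ x) (fderiv ℝ φ x z) (fderiv ℝ φ x a) (fderiv ℝ φ x a) +
      H (φ x) (fderiv ℝ (fderiv ℝ φ) x a a) (fderiv ℝ φ x z) := by
  have key : ∀ w ∈ S, ∀ u, fderiv ℝ G x u w w =
      fderiv ℝ H (φ x) (fderiv ℝ φ x u) (fderiv ℝ φ x w) (fderiv ℝ φ x w) +
        H (φ x) (fderiv ℝ (fderiv ℝ φ) x u w) (fderiv ℝ φ x w) +
        H (φ x) (fderiv ℝ φ x w) (fderiv ℝ (fderiv ℝ φ) x u w) := fun w hw u ↦ by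
    obtain ⟨L, hL, hLu⟩ := hasFDerivAt_pullback hH hφ w
    have hGw := (hG.hasFDerivAt.clm_apply (hasFDerivAt_const w x)).clm_apply
      (hasFDerivAt_const w x)
    -- The difference is nonnegative near `x` and zero at `x`, so its derivative vanishes in every
    -- direction `u`, not only those in `S`.
    have hmin : IsLocalMin (fun y ↦ G y w w - H (φ y) (fderiv ℝ φ y w) (fderiv ℝ φ y w)) x := by
      filter_upwards [hle] with y hy
      simpa [heq w hw] using hy w
    have h0 := hmin.hasFDerivAt_eq_zero (hGw.sub hL)
    have h0u := DFunLike.congr_fun h0 u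
    rw [← hLu]
    simpa [sub_eq_zero] using h0u
  have hDG : ∀ u v w, fderiv ℝ G x u v w = fderiv ℝ G x u w v := fun u v w ↦ by
    have h1 := (hG.hasFDerivAt.clm_apply (hasFDerivAt_const v x)).clm_apply
      (hasFDerivAt_const w x)
    have h2 := (hG.hasFDerivAt.clm_apply (hasFDerivAt_const w x)).clm_apply
      (hasFDerivAt_const v x)
    simp_rw [fun y ↦ hGs y v w] at h1
    simpa using DFunLike.congr_fun (h1.unique h2) u
  have hDH : ∀ u v w, fderiv ℝ H (φ x) u v w = fderiv ℝ H (φ x) u w v := fun u v w ↦ by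
    have h1 := (hH.hasFDerivAt.clm_apply (hasFDerivAt_const v _)).clm_apply
      (hasFDerivAt_const w _)
    have h2 := (hH.hasFDerivAt.clm_apply (hasFDerivAt_const w _)).clm_apply
      (hasFDerivAt_const v _)
    simp_rw [fun y ↦ hHs y v w] at h1
    simpa using DFunLike.congr_fun (h1.unique h2) u
  have hsymm : fderiv ℝ (fderiv ℝ φ) x z a = fderiv ℝ (fderiv ℝ φ) x a z :=
    (hφ.isSymmSndFDerivAt (by simp)) z a
  -- Polarisation: `k1 - k2 - k3` gives the derivative along `a` of `G(a, z)`, and half of `k4` is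
  -- subtracted. The terms in `D²φ(a, z)` cancel and only `D²φ(a, a)` survives.
  have k1 := key (a + z) (S.add_mem ha hz) a
  have k2 := key a ha a
  have k3 := key z hz a
  have k4 := key a ha z
  rw [hsymm] at k4
  simp only [map_add, add_apply] at k1
  have s1 := hDG a z a
  have s2 := hDH (fderiv ℝ φ x a) (fderiv ℝ φ x z) (fderiv ℝ φ x a)
  have s3 := hHs (φ x) (fderiv ℝ φ x a) (fderiv ℝ (fderiv ℝ φ) x a z)
  have s4 := hHs (φ x) (fderiv ℝ φ x z) (fderiv ℝ (fderiv ℝ φ) x a a)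
  linarith

end Calculus

/-! ### Riemannian submersions in charts; the Hessian on horizontal vectors -/

section Submersion

variable {m n : ℕ}
  {E : Type*} [TopologicalSpace E] [ChartedSpace (EuclideanSpace ℝ (Fin m)) E]
  {B : Type*} [TopologicalSpace B] [ChartedSpace (EuclideanSpace ℝ (Fin n)) B]

/-- The expression of `pr` in the charts at `p` and at `pr p`. -/
def chartRep (m n : ℕ) {E : Type*} [TopologicalSpace E]
    [ChartedSpace (EuclideanSpace ℝ (Fin m)) E] {B : Type*} [TopologicalSpace B]
    [ChartedSpace (EuclideanSpace ℝ (Fin n)) B] (pr : E → B) (p : E) :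
    EuclideanSpace ℝ (Fin m) → EuclideanSpace ℝ (Fin n) :=
  (extChartAt (𝓡 n) (pr p) ∘ pr) ∘ (extChartAt (𝓡 m) p).symm

theorem chartRep_extChartAt {pr : E → B} {p q : E} (hq : q ∈ (extChartAt (𝓡 m) p).source) :
    chartRep m n pr p (extChartAt (𝓡 m) p q) = extChartAt (𝓡 n) (pr p) (pr q) := by
  rw [chartRep, Function.comp_apply, (extChartAt (𝓡 m) p).left_inv hq, Function.comp_apply]

variable [IsManifold (𝓡 m) ∞ E] [IsManifold (𝓡 n) ∞ B]

omit [IsManifold (𝓡 m) ∞ E] in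
theorem contMDiffAt_extChartAt_comp {pr : E → B} (hpr : ContMDiff (𝓡 m) (𝓡 n) ∞ pr) {p q : E}
    (hq : pr q ∈ (extChartAt (𝓡 n) (pr p)).source) :
    ContMDiffAt (𝓡 m) 𝓘(ℝ, EuclideanSpace ℝ (Fin n)) ∞ (extChartAt (𝓡 n) (pr p) ∘ pr) q :=
  (contMDiffAt_extChartAt' (by simpa [extChartAt_source] using hq)).comp q (hpr q)

theorem contDiffAt_chartRep {pr : E → B} (hpr : ContMDiff (𝓡 m) (𝓡 n) ∞ pr) {p q : E}
    (hq : q ∈ (extChartAt (𝓡 m) p).source) (hq' : pr q ∈ (extChartAt (𝓡 n) (pr p)).source) :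
    ContDiffAt ℝ ∞ (chartRep m n pr p) (extChartAt (𝓡 m) p q) :=
  contDiffAt_comp_extChartAt_symm hq (contMDiffAt_extChartAt_comp hpr hq')

theorem fderiv_chartRep {pr : E → B} (hpr : ContMDiff (𝓡 m) (𝓡 n) ∞ pr) {p q : E}
    (hq : q ∈ (extChartAt (𝓡 m) p).source) (hq' : pr q ∈ (extChartAt (𝓡 n) (pr p)).source)
    (v : TangentSpace (𝓡 m) q) :
    fderiv ℝ (chartRep m n pr p) (extChartAt (𝓡 m) p q) (toCoord m p q v) =
      toCoord n (pr p) (pr q) (mfderiv (𝓡 m) (𝓡 n) pr q v) := by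
  rw [chartRep, fderiv_comp_extChartAt_symm hq (contMDiffAt_extChartAt_comp hpr hq'),
    mvfderiv_comp_apply _ ((hpr q).mdifferentiableAt (by simp)), toCoord_eq_mvfderiv hq']
  exact mdifferentiableAt_extChartAt (by simpa [extChartAt_source] using hq')

omit [IsManifold (𝓡 m) ∞ E] [IsManifold (𝓡 n) ∞ B] in
theorem eventually_mem_source {pr : E → B} (hpr : Continuous pr) (p : E) :
    ∀ᶠ q in 𝓝 p, q ∈ (extChartAt (𝓡 m) p).source ∧
      pr q ∈ (extChartAt (𝓡 n) (pr p)).source :=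
  Filter.Eventually.and (extChartAt_source_mem_nhds p)
    (hpr.continuousAt.eventually (extChartAt_source_mem_nhds (pr p)))

variable [RiemannianBundle (fun x : E ↦ TangentSpace (𝓡 m) x)]
  [RiemannianBundle (fun x : B ↦ TangentSpace (𝓡 n) x)]

namespace IsRiemannianSubmersion

variable {pr : E → B}

omit [IsManifold (𝓡 m) ∞ E] [IsManifold (𝓡 n) ∞ B] in
-- The vertical part of `v` contributes nothing to either side, and on horizontal vectors an
-- isometry of norms polarises to inner products.
theorem inner_mfderiv_mfderiv (hpr : IsRiemannianSubmersion m n pr) {p : E}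
    (v : TangentSpace (𝓡 m) p) {z : TangentSpace (𝓡 m) p} (hz : z ∈ (vertical m n pr p)ᗮ) :
    inner ℝ (mfderiv (𝓡 m) (𝓡 n) pr p v) (mfderiv (𝓡 m) (𝓡 n) pr p z) = inner ℝ v z := by
  obtain ⟨a, ha, b, hb, rfl⟩ := (vertical m n pr p).exists_add_mem_mem_orthogonal v
  have ha' : mfderiv (𝓡 m) (𝓡 n) pr p a = 0 := ha
  have h1 := hpr.isometric p (b + z) (Submodule.add_mem _ hb hz)
  have h2 := hpr.isometric p b hb
  have h3 := hpr.isometric p z hz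
  rw [map_add, ha', zero_add, inner_add_left, hz a ha, zero_add,
    real_inner_eq_norm_add_mul_self_sub_norm_mul_self_sub_norm_mul_self_div_two,
    real_inner_eq_norm_add_mul_self_sub_norm_mul_self_sub_norm_mul_self_div_two,
    ← map_add, h1, h2, h3]

omit [IsManifold (𝓡 m) ∞ E] [IsManifold (𝓡 n) ∞ B] in
-- The differential discards the vertical component and preserves the norm of the orthogonal rest.
theorem norm_mfderiv_le (hpr : IsRiemannianSubmersion m n pr) {p : E}
    (v : TangentSpace (𝓡 m) p) : ‖mfderiv (𝓡 m) (𝓡 n) pr p v‖ ≤ ‖v‖ := by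
  obtain ⟨a, ha, b, hb, rfl⟩ := (vertical m n pr p).exists_add_mem_mem_orthogonal v
  have ha' : mfderiv (𝓡 m) (𝓡 n) pr p a = 0 := ha
  have h := norm_add_sq_eq_norm_sq_add_norm_sq_real (hb a ha)
  rw [map_add, ha', zero_add, hpr.isometric p b hb]
  nlinarith [norm_nonneg (a + b), norm_nonneg b, mul_self_nonneg ‖a‖]

omit [IsManifold (𝓡 m) ∞ E] [IsManifold (𝓡 n) ∞ B] in
theorem exists_horizontal_lift (hpr : IsRiemannianSubmersion m n pr) (p : E)
    (y : TangentSpace (𝓡 n) (pr p)) :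
    ∃ z ∈ (vertical m n pr p)ᗮ, mfderiv (𝓡 m) (𝓡 n) pr p z = y := by
  obtain ⟨v, rfl⟩ := hpr.surjective_mfderiv p y
  obtain ⟨a, ha, b, hb, rfl⟩ := (vertical m n pr p).exists_add_mem_mem_orthogonal v
  have ha' : mfderiv (𝓡 m) (𝓡 n) pr p a = 0 := ha
  exact ⟨b, hb, by rw [map_add, ha', zero_add]⟩

omit [IsManifold (𝓡 m) ∞ E] [IsManifold (𝓡 n) ∞ B] in
/-- The differential of a Riemannian submersion, as an isometry of the horizontal space with the
tangent space of the base. -/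
def horizontalIsometry (hpr : IsRiemannianSubmersion m n pr) (p : E) :
    (vertical m n pr p)ᗮ ≃ₗᵢ[ℝ] TangentSpace (𝓡 n) (pr p) :=
  LinearIsometryEquiv.ofSurjective
    { toLinearMap := (mfderiv (𝓡 m) (𝓡 n) pr p).toLinearMap.comp
        (vertical m n pr p)ᗮ.subtype
      norm_map' := fun v ↦ hpr.isometric p v v.2 }
    fun y ↦ by
      obtain ⟨z, hz, rfl⟩ := hpr.exists_horizontal_lift p y
      exact ⟨⟨z, hz⟩, rfl⟩

/-- This is `norm_mfderiv_le` read in charts: the domination hypothesis of `christoffel_pullback`.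
-/
theorem chartMetric_chartRep_le (hpr : IsRiemannianSubmersion m n pr) (p : E) :
    ∀ᶠ y in 𝓝 (extChartAt (𝓡 m) p p), ∀ u,
      chartMetric n (pr p) (chartRep m n pr p y) (fderiv ℝ (chartRep m n pr p) y u)
        (fderiv ℝ (chartRep m n pr p) y u) ≤ chartMetric m p y u u := by
  have h := (continuousAt_extChartAt_symm (I := 𝓡 m) p).eventually <| by
    rw [extChartAt_to_inv]
    exact eventually_mem_source (m := m) (n := n) hpr.smooth.continuous p
  filter_upwards [h, extChartAt_target_mem_nhds (I := 𝓡 m) p] with y ⟨hq, hq'⟩ hy u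
  generalize hqy : (extChartAt (𝓡 m) p).symm y = q at hq hq'
  obtain rfl : extChartAt (𝓡 m) p q = y := by rw [← hqy, (extChartAt (𝓡 m) p).right_inv hy]
  conv_lhs => rw [← toCoord_ofCoord hq u, fderiv_chartRep hpr.smooth hq hq',
    chartRep_extChartAt hq, chartMetric_extChartAt hq', ofCoord_toCoord hq']
  rw [chartMetric_extChartAt hq, real_inner_self_eq_norm_sq, real_inner_self_eq_norm_sq]
  gcongr
  exact hpr.norm_mfderiv_le _

variable [IsContMDiffRiemannianBundle (𝓡 m) ∞ (EuclideanSpace ℝ (Fin m))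
      (fun x : E ↦ TangentSpace (𝓡 m) x)]
  [IsContMDiffRiemannianBundle (𝓡 n) ∞ (EuclideanSpace ℝ (Fin n))
      (fun x : B ↦ TangentSpace (𝓡 n) x)]

/-- The second fundamental form of a Riemannian submersion vanishes on horizontal vectors. -/
theorem mfderiv_christoffel (hpr : IsRiemannianSubmersion m n pr) {p : E}
    {x : TangentSpace (𝓡 m) p} (hx : x ∈ (vertical m n pr p)ᗮ) :
    mfderiv (𝓡 m) (𝓡 n) pr p (christoffel m p (toCoord m p p x) (toCoord m p p x)) =
      christoffel n (pr p) (toCoord n (pr p) (pr p) (mfderiv (𝓡 m) (𝓡 n) pr p x))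
          (toCoord n (pr p) (pr p) (mfderiv (𝓡 m) (𝓡 n) pr p x)) +
        ofCoord n (pr p) (pr p) (fderiv ℝ (fderiv ℝ (chartRep m n pr p)) (extChartAt (𝓡 m) p p)
          (toCoord m p p x) (toCoord m p p x)) := by
  have hp : p ∈ (extChartAt (𝓡 m) p).source := mem_extChartAt_source p
  have hb : pr p ∈ (extChartAt (𝓡 n) (pr p)).source := mem_extChartAt_source (pr p)
  have hrep : chartRep m n pr p (extChartAt (𝓡 m) p p) = extChartAt (𝓡 n) (pr p) (pr p) :=
    chartRep_extChartAt hp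
  refine ext_inner_right ℝ fun y ↦ ?_
  -- Every test vector on the base lifts horizontally, so both vectors compared by the Christoffel
  -- form lie in the subspace where the metrics agree.
  obtain ⟨z, hz, rfl⟩ := hpr.exists_horizontal_lift p y
  rw [hpr.inner_mfderiv_mfderiv _ hz, inner_christoffel, inner_add_left, inner_christoffel,
    christoffelForm_self, christoffelForm_self]
  have h := christoffel_pullback (G := chartMetric m p) (H := chartMetric n (pr p))
    (φ := chartRep m n pr p) (x := extChartAt (𝓡 m) p p) (differentiableAt_chartMetric p)
    (by rw [hrep]; exact differentiableAt_chartMetric (pr p))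
    ((contDiffAt_chartRep hpr.smooth hp hb).of_le ENat.LEInfty.out)
    (chartMetric_symm p) (chartMetric_symm (pr p)) (hpr.chartMetric_chartRep_le p)
    ((vertical m n pr p)ᗮ.map (toCoord m p p).toLinearMap) (by
      rintro _ ⟨v, hv, rfl⟩
      simp only [ContinuousLinearMap.coe_coe]
      rw [fderiv_chartRep hpr.smooth hp hb, hrep, chartMetric_extChartAt hb,
        chartMetric_extChartAt hp, ofCoord_toCoord hb, ofCoord_toCoord hp,
        hpr.inner_mfderiv_mfderiv _ hv])
    (a := toCoord m p p x) (z := toCoord m p p z) ⟨x, hx, rfl⟩ ⟨z, hz, rfl⟩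
  rw [h, fderiv_chartRep hpr.smooth hp hb, fderiv_chartRep hpr.smooth hp hb, hrep,
    chartMetric_extChartAt hb, ofCoord_toCoord hb]

/-- The chain rule for second derivatives adds the term `df(D²φ(x, x))`, with `φ` the chart
expression of `pr`; `mfderiv_christoffel` produces the same term, and the two cancel. -/
theorem hessian_comp_horizontal (hpr : IsRiemannianSubmersion m n pr) {f : B → ℝ}
    (hf : ContMDiff (𝓡 n) 𝓘(ℝ, ℝ) ∞ f) {p : E}
    {x : TangentSpace (𝓡 m) p} (hx : x ∈ (vertical m n pr p)ᗮ) :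
    hessian m (f ∘ pr) p x x =
      hessian n f (pr p) (mfderiv (𝓡 m) (𝓡 n) pr p x) (mfderiv (𝓡 m) (𝓡 n) pr p x) := by
  have hp : p ∈ (extChartAt (𝓡 m) p).source := mem_extChartAt_source p
  have hb : pr p ∈ (extChartAt (𝓡 n) (pr p)).source := mem_extChartAt_source (pr p)
  have hrep : chartRep m n pr p (extChartAt (𝓡 m) p p) = extChartAt (𝓡 n) (pr p) (pr p) :=
    chartRep_extChartAt hp
  have h := (continuousAt_extChartAt_symm (I := 𝓡 m) p).eventually <| by
    rw [extChartAt_to_inv]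
    exact eventually_mem_source (m := m) (n := n) hpr.smooth.continuous p
  have heq : (f ∘ pr) ∘ (extChartAt (𝓡 m) p).symm =ᶠ[𝓝 (extChartAt (𝓡 m) p p)]
      (f ∘ (extChartAt (𝓡 n) (pr p)).symm) ∘ chartRep m n pr p := by
    filter_upwards [h] with y hy
    simp only [chartRep, Function.comp_apply]
    rw [(extChartAt (𝓡 n) (pr p)).left_inv hy.2]
  have hfc := contDiffAt_comp_extChartAt_symm hb (hf (pr p))
  have hDf := fderiv_comp_extChartAt_symm hb (hf (pr p))
  rw [hessian, hessian, heq.fderiv.fderiv_eq, fderiv_fderiv_comp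
      (by rw [hrep]; exact hfc.of_le ENat.LEInfty.out)
      ((contDiffAt_chartRep hpr.smooth hp hb).of_le ENat.LEInfty.out),
    mvfderiv_comp_apply ((hf _).mdifferentiableAt (by simp))
      ((hpr.smooth p).mdifferentiableAt (by simp)), hpr.mfderiv_christoffel hx, map_add,
    fderiv_chartRep hpr.smooth hp hb, hrep, ← hDf (ofCoord n _ _ _), toCoord_ofCoord hb]
  ring

end IsRiemannianSubmersion

end Submersion

/-! ### Bilinearity of the Hessian; the Hessian along fields tangent to level sets -/

section Hessian

variable {m : ℕ} {E : Type*} [TopologicalSpace E] [ChartedSpace (EuclideanSpace ℝ (Fin m)) E]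
  [IsManifold (𝓡 m) ∞ E] [RiemannianBundle (fun x : E ↦ TangentSpace (𝓡 m) x)]

set_option synthInstance.maxHeartbeats 200000 in
theorem christoffel_add_left (p : E) (u u' v : EuclideanSpace ℝ (Fin m)) :
    christoffel m p (u + u') v = christoffel m p u v + christoffel m p u' v := by
  refine ext_inner_right ℝ fun w ↦ ?_
  simp only [inner_add_left, inner_christoffel, christoffelForm_apply, map_add, add_apply]
  ring

set_option synthInstance.maxHeartbeats 200000 in
theorem christoffel_add_right (p : E) (u v v' : EuclideanSpace ℝ (Fin m)) :
    christoffel m p u (v + v') = christoffel m p u v + christoffel m p u v' := by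
  refine ext_inner_right ℝ fun w ↦ ?_
  simp only [inner_add_left, inner_christoffel, christoffelForm_apply, map_add, add_apply]
  ring

set_option synthInstance.maxHeartbeats 200000 in
theorem christoffel_smul_left (p : E) (c : ℝ) (u v : EuclideanSpace ℝ (Fin m)) :
    christoffel m p (c • u) v = c • christoffel m p u v := by
  refine ext_inner_right ℝ fun w ↦ ?_
  simp only [real_inner_smul_left, inner_christoffel, christoffelForm_apply, map_smul, smul_apply, smul_eq_mul]
  ring

set_option synthInstance.maxHeartbeats 200000 in
theorem christoffel_smul_right (p : E) (c : ℝ) (u v : EuclideanSpace ℝ (Fin m)) :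
    christoffel m p u (c • v) = c • christoffel m p u v := by
  refine ext_inner_right ℝ fun w ↦ ?_
  simp only [real_inner_smul_left, inner_christoffel, christoffelForm_apply, map_smul, smul_apply, smul_eq_mul]
  ring

/-- The Hessian as a bilinear map. -/
def hessianBilin (f : E → ℝ) (p : E) :
    TangentSpace (𝓡 m) p →ₗ[ℝ] TangentSpace (𝓡 m) p →ₗ[ℝ] ℝ :=
  LinearMap.mk₂ ℝ (hessian m f p)
    (fun u u' v ↦ by simp only [hessian, map_add, christoffel_add_left, add_apply]; ring)
    (fun c u v ↦ by
      simp only [hessian, map_smul, christoffel_smul_left, smul_apply, smul_eq_mul]; ring)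
    (fun u v v' ↦ by simp only [hessian, map_add, christoffel_add_right]; ring)
    (fun c u v ↦ by
      simp only [hessian, map_smul, christoffel_smul_right, smul_eq_mul]; ring)

@[simp]
theorem hessianBilin_apply (f : E → ℝ) (p : E) (v w : TangentSpace (𝓡 m) p) :
    hessianBilin f p v w = hessian m f p v w := rfl

omit [RiemannianBundle (fun x : E ↦ TangentSpace (𝓡 m) x)] in
theorem differentiableAt_toCoord_section {W : ∀ q : E, TangentSpace (𝓡 m) q} {p : E}
    (hW : ContMDiffAt (𝓡 m) (𝓡 m).tangent ∞
      (fun q ↦ (TotalSpace.mk' (EuclideanSpace ℝ (Fin m)) q (W q) : TangentBundle (𝓡 m) E)) p) :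
    DifferentiableAt ℝ (fun y ↦ toCoord m p ((extChartAt (𝓡 m) p).symm y)
      (W ((extChartAt (𝓡 m) p).symm y))) (extChartAt (𝓡 m) p p) := by
  have h := (Bundle.Trivialization.contMDiffAt_section_iff (trivializationAt
    (EuclideanSpace ℝ (Fin m)) (TangentSpace (𝓡 m) : E → Type _) p)
    (by simp)).1 hW
  have h' : ContMDiffAt (𝓡 m) 𝓘(ℝ, EuclideanSpace ℝ (Fin m)) ∞ (fun q ↦ toCoord m p q (W q)) p := by
    refine h.congr_of_eventuallyEq ?_
    filter_upwards [extChartAt_source_mem_nhds (I := 𝓡 m) p] with x hx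
    rw [toCoord, Bundle.Trivialization.continuousLinearMapAt_apply,
      Bundle.Trivialization.coe_linearMapAt_of_mem _
      (by simpa [extChartAt_source] using hx)]
  exact (contDiffAt_comp_extChartAt_symm (mem_extChartAt_source p) h').differentiableAt (by simp)

/-- `H_F(v, W) = -dF(∇_v W)` for a vector field `W` along which `F` is constant. -/
theorem hessian_eq_neg_covDeriv {F : E → ℝ} (hF : ContMDiff (𝓡 m) 𝓘(ℝ, ℝ) ∞ F)
    {W : ∀ q : E, TangentSpace (𝓡 m) q} {p : E}
    (hW : ContMDiffAt (𝓡 m) (𝓡 m).tangent ∞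
      (fun q ↦ (TotalSpace.mk' (EuclideanSpace ℝ (Fin m)) q (W q) : TangentBundle (𝓡 m) E)) p)
    (hFW : ∀ᶠ q in 𝓝 p, mvfderiv (𝓡 m) F q (W q) = 0) (v : TangentSpace (𝓡 m) p) :
    hessian m F p v (W p) = -mvfderiv (𝓡 m) F p (covDeriv m p v W) := by
  have hp : p ∈ (extChartAt (𝓡 m) p).source := mem_extChartAt_source p
  have hFc := contDiffAt_comp_extChartAt_symm hp (hF p)
  have hd : DifferentiableAt ℝ (fderiv ℝ (F ∘ (extChartAt (𝓡 m) p).symm))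
      (extChartAt (𝓡 m) p p) :=
    (hFc.fderiv_right (m := 1) (by norm_cast)).differentiableAt (by simp)
  have hWd := differentiableAt_toCoord_section hW
  have hev := (continuousAt_extChartAt_symm (I := 𝓡 m) p).eventually <| by
    rw [extChartAt_to_inv]
    exact hFW.and (extChartAt_source_mem_nhds (I := 𝓡 m) p)
  -- In coordinates `dF(W)` vanishes near `p`; differentiating along `v` gives `D²F(v, W) + DF(D_v
  -- W) = 0`, and the Christoffel terms of `hessian` and `covDeriv` match.
  have h0 : (fun y ↦ fderiv ℝ (F ∘ (extChartAt (𝓡 m) p).symm) y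
      (toCoord m p ((extChartAt (𝓡 m) p).symm y) (W ((extChartAt (𝓡 m) p).symm y))))
      =ᶠ[𝓝 (extChartAt (𝓡 m) p p)] fun _ ↦ 0 := by
    filter_upwards [hev, extChartAt_target_mem_nhds (I := 𝓡 m) p] with y ⟨h1, h2⟩ hy
    generalize hqy : (extChartAt (𝓡 m) p).symm y = q at h1 h2
    obtain rfl : extChartAt (𝓡 m) p q = y := by
      rw [← hqy, (extChartAt (𝓡 m) p).right_inv hy]
    rw [fderiv_comp_extChartAt_symm h2 (hF q), h1]
  have h1 := (hd.hasFDerivAt.clm_apply hWd.hasFDerivAt).unique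
    ((hasFDerivAt_const (0 : ℝ) _).congr_of_eventuallyEq h0)
  have h2 := DFunLike.congr_fun h1 (toCoord m p p v)
  simp only [add_apply, ContinuousLinearMap.comp_apply, ContinuousLinearMap.flip_apply,
    zero_apply] at h2
  have key : ∀ q, q = p → toCoord m p q (W q) = toCoord m p p (W p) := by rintro _ rfl; rfl
  rw [key _ ((extChartAt (𝓡 m) p).left_inv hp)] at h2
  rw [hessian, covDeriv, map_add, ← fderiv_comp_extChartAt_symm hp (hF p) (ofCoord m p p _),
    toCoord_ofCoord hp]
  linarith

end Hessian

/-! ### Vertical fields and the vertical trace of the Hessian -/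

section Minimal

variable {m n : ℕ}
  {E : Type*} [TopologicalSpace E] [ChartedSpace (EuclideanSpace ℝ (Fin m)) E]
  [IsManifold (𝓡 m) ∞ E]
  {B : Type*} [TopologicalSpace B] [ChartedSpace (EuclideanSpace ℝ (Fin n)) B]
  [IsManifold (𝓡 n) ∞ B]

/-- Minimality is stated through vertical extensions of a basis, so it can be used only once such
extensions exist. The chart-constant extension of `v` is projected onto the kernel of the
differential `D q`, along the range of a right inverse `R` of `D p`. -/
theorem exists_isVerticalFieldNear {pr : E → B} (hpr : ContMDiff (𝓡 m) (𝓡 n) ∞ pr) {p : E}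
    (hs : Function.Surjective (mfderiv (𝓡 m) (𝓡 n) pr p)) {v : TangentSpace (𝓡 m) p}
    (hv : v ∈ vertical m n pr p) :
    ∃ W : ∀ q : E, TangentSpace (𝓡 m) q, IsVerticalFieldNear m n pr p W ∧ W p = v := by
  have hp : p ∈ (extChartAt (𝓡 m) p).source := mem_extChartAt_source p
  have hb : pr p ∈ (extChartAt (𝓡 n) (pr p)).source := mem_extChartAt_source (pr p)
  have hv' : mfderiv (𝓡 m) (𝓡 n) pr p v = 0 := hv
  set D : E → EuclideanSpace ℝ (Fin m) →L[ℝ] EuclideanSpace ℝ (Fin n) :=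
    fun q ↦ fderiv ℝ (chartRep m n pr p) (extChartAt (𝓡 m) p q) with hD
  have hDsurj : Function.Surjective (D p) := fun y ↦ by
    obtain ⟨u, hu⟩ := hs (ofCoord n (pr p) (pr p) y)
    exact ⟨toCoord m p p u, by
      simp only [hD]
      rw [fderiv_chartRep hpr hp hb, hu, toCoord_ofCoord hb]⟩
  obtain ⟨R, hR⟩ := (D p).exists_rightInverse_of_surjective (LinearMap.range_eq_top.2 hDsurj)
  have hDsmooth : ∀ q ∈ (extChartAt (𝓡 m) p).source,
      pr q ∈ (extChartAt (𝓡 n) (pr p)).source → ContMDiffAt (𝓡 m)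
        𝓘(ℝ, EuclideanSpace ℝ (Fin m) →L[ℝ] EuclideanSpace ℝ (Fin n)) ∞ D q := fun q hq hq' ↦
    ((contDiffAt_chartRep hpr hq hq').fderiv_right (m := ∞) (by simp)).contMDiffAt.comp q
      (contMDiffAt_extChartAt' (by simpa [extChartAt_source] using hq))
  -- At `p` this composite is the identity, and invertibility is an open condition.
  have hinv : ∀ᶠ q in 𝓝 p, ((D q).comp R).IsInvertible := by
    have hc : ContinuousAt (fun q ↦ (D q).comp R) p :=
      (hDsmooth p hp hb).continuousAt.clm_comp continuousAt_const
    have h := ContinuousLinearEquiv.nhds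
      (ContinuousLinearEquiv.refl ℝ (EuclideanSpace ℝ (Fin n)))
    refine hc.eventually ?_
    change _ ∈ 𝓝 ((D p).comp R)
    rw [hR]
    exact h
  obtain ⟨U, hU, hUo, hpU⟩ := eventually_nhds_iff.1
    (hinv.and (eventually_mem_source (m := m) (n := n) hpr.continuous p))
  set w : E → EuclideanSpace ℝ (Fin m) := fun q ↦
    toCoord m p p v - R (((D q).comp R).inverse (D q (toCoord m p p v))) with hw
  have hws : ∀ q ∈ U, ContMDiffAt (𝓡 m) 𝓘(ℝ, EuclideanSpace ℝ (Fin m)) ∞ w q := fun q hq ↦ by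
    obtain ⟨hi, hq1, hq2⟩ := hU q hq
    have h1 := hDsmooth q hq1 hq2
    have h2 : ContDiffAt ℝ ∞ (fun A : EuclideanSpace ℝ (Fin m) →L[ℝ] EuclideanSpace ℝ (Fin n) ↦
        toCoord m p p v - R ((A.comp R).inverse (A (toCoord m p p v)))) (D q) := by
      have h3 : ContDiffAt ℝ ∞ (fun A : EuclideanSpace ℝ (Fin m) →L[ℝ]
          EuclideanSpace ℝ (Fin n) ↦ A.comp R) (D q) := contDiffAt_id.clm_comp contDiffAt_const
      have h4 := ContDiffAt.comp (D q) (hi.contDiffAt_map_inverse (n := ∞)) h3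
      exact contDiffAt_const.sub (contDiffAt_const.clm_apply
        (h4.clm_apply (contDiffAt_id.clm_apply contDiffAt_const)))
    exact h2.contMDiffAt.comp q h1
  refine ⟨fun q ↦ ofCoord m p q (w q), ⟨U, hUo, hpU, fun q hq ↦
    (contMDiffAt_ofCoord (hU q hq).2.1 (hws q hq)).contMDiffWithinAt, fun q hq ↦ ?_⟩, ?_⟩
  · obtain ⟨hi, hq1, hq2⟩ := hU q hq
    have h := fderiv_chartRep hpr hq1 hq2 (ofCoord m p q (w q))
    have h0 : D q (w q) = 0 := by
      have h5 := DFunLike.congr_fun hi.self_comp_inverse (D q (toCoord m p p v))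
      simp only [ContinuousLinearMap.comp_apply, ContinuousLinearMap.id_apply] at h5
      simp only [hw, map_sub, h5, sub_self]
    rw [toCoord_ofCoord hq1] at h
    replace h := h.symm.trans h0
    change mfderiv (𝓡 m) (𝓡 n) pr q (ofCoord m p q (w q)) = 0
    rw [← ofCoord_toCoord hq2 (mfderiv (𝓡 m) (𝓡 n) pr q (ofCoord m p q (w q))), h, map_zero]
  -- The correction term vanishes at `p` because `v` is already vertical.
  · have h : D p (toCoord m p p v) = 0 := by
      simp only [hD]
      rw [fderiv_chartRep hpr hp hb, hv', map_zero]
    simp only [hw, h, map_zero, sub_zero]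
    exact ofCoord_toCoord hp v

variable [RiemannianBundle (fun x : E ↦ TangentSpace (𝓡 m) x)]

/-- The differential of `f ∘ pr` kills vertical vectors, so only the normal part of each `∇_{e i} (W
i)` is seen. By linearity the sum is minus the differential applied to the trace of the second
fundamental form. -/
theorem HasMinimalFibres.sum_hessian_comp_vertical {pr : E → B}
    (hmin : HasMinimalFibres m n pr) (hpr : ContMDiff (𝓡 m) (𝓡 n) ∞ pr) {f : B → ℝ}
    (hf : ContMDiff (𝓡 n) 𝓘(ℝ, ℝ) ∞ f) {p : E}
    (hs : Function.Surjective (mfderiv (𝓡 m) (𝓡 n) pr p)) {k : ℕ}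
    (e : OrthonormalBasis (Fin k) ℝ (vertical m n pr p)) :
    ∑ i, hessian m (f ∘ pr) p (e i) (e i) = 0 := by
  choose W hW hWp using fun i ↦ exists_isVerticalFieldNear hpr hs (e i).2
  have hvert : ∀ (q : E) (v : TangentSpace (𝓡 m) q), v ∈ vertical m n pr q →
      mvfderiv (𝓡 m) (f ∘ pr) q v = 0 := fun q v hv ↦ by
    rw [mvfderiv_comp_apply ((hf _).mdifferentiableAt (by simp))
      ((hpr q).mdifferentiableAt (by simp)), show mfderiv (𝓡 m) (𝓡 n) pr q v = 0 from hv,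
      map_zero]
  have key : ∀ i, hessian m (f ∘ pr) p (e i) (e i) =
      -mvfderiv (𝓡 m) (f ∘ pr) p (fibreSecondForm m n pr p (e i) (W i)) := fun i ↦ by
    obtain ⟨U, hUo, hpU, hWs, hWv⟩ := hW i
    have h := hessian_eq_neg_covDeriv (hf.comp hpr) (hWs.contMDiffAt (hUo.mem_nhds hpU))
      (by filter_upwards [hUo.mem_nhds hpU] with q hq using hvert q _ (hWv q hq)) (e i)
    rw [hWp i] at h
    have h' := (vertical m n pr p).starProjection_add_starProjection_orthogonal
      (covDeriv m p (e i) (W i))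
    rw [h, fibreSecondForm]
    conv_lhs => rw [← h', map_add, hvert p _ (Submodule.starProjection_apply_mem _ _), zero_add]
  simp_rw [key]
  rw [Finset.sum_neg_distrib, ← map_sum, hmin p k e W hW hWp, map_zero, neg_zero]

end Minimal

/-! ### Laplacian, gradient and focal varieties of the composite -/

section Isoparametric

variable {m n : ℕ}
  {E : Type*} [TopologicalSpace E] [ChartedSpace (EuclideanSpace ℝ (Fin m)) E]
  [IsManifold (𝓡 m) ∞ E] [RiemannianBundle (fun x : E ↦ TangentSpace (𝓡 m) x)]
  {B : Type*} [TopologicalSpace B] [ChartedSpace (EuclideanSpace ℝ (Fin n)) B]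
  [IsManifold (𝓡 n) ∞ B] [RiemannianBundle (fun x : B ↦ TangentSpace (𝓡 n) x)]
  {pr : E → B} {f : B → ℝ}

namespace IsRiemannianSubmersion

theorem laplacian_comp [IsContMDiffRiemannianBundle (𝓡 m) ∞ (EuclideanSpace ℝ (Fin m))
      (fun x : E ↦ TangentSpace (𝓡 m) x)]
    [IsContMDiffRiemannianBundle (𝓡 n) ∞ (EuclideanSpace ℝ (Fin n))
      (fun x : B ↦ TangentSpace (𝓡 n) x)]
    (hpr : IsRiemannianSubmersion m n pr) (hmin : HasMinimalFibres m n pr)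
    (hf : ContMDiff (𝓡 n) 𝓘(ℝ, ℝ) ∞ f) (p : E) :
    laplacian m (f ∘ pr) p = laplacian n f (pr p) := by
  -- The horizontal basis is the lift of the standard basis downstairs, so the horizontal sum
  -- matches the Laplacian of `f` term by term.
  have h := sum_bilin_eq_add_orthogonal (hessianBilin (f ∘ pr) p) (vertical m n pr p)
    (stdOrthonormalBasis ℝ (TangentSpace (𝓡 m) p)) (stdOrthonormalBasis ℝ (vertical m n pr p))
    ((stdOrthonormalBasis ℝ (TangentSpace (𝓡 n) (pr p))).map (hpr.horizontalIsometry p).symm)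
  simp only [hessianBilin_apply] at h
  rw [laplacian, h, hmin.sum_hessian_comp_vertical hpr.smooth hf (hpr.surjective_mfderiv p),
    zero_add, laplacian]
  refine Finset.sum_congr rfl fun i _ ↦ ?_
  rw [hpr.hessian_comp_horizontal hf (Subtype.prop _), OrthonormalBasis.map_apply]
  have h2 := (hpr.horizontalIsometry p).apply_symm_apply
    (stdOrthonormalBasis ℝ (TangentSpace (𝓡 n) (pr p)) i)
  exact congrArg₂ (hessian n f (pr p)) h2 h2

omit [IsManifold (𝓡 m) ∞ E] [IsManifold (𝓡 n) ∞ B] in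
theorem norm_grad_comp (hpr : IsRiemannianSubmersion m n pr)
    (hf : ContMDiff (𝓡 n) 𝓘(ℝ, ℝ) ∞ f) (p : E) :
    ‖grad m (f ∘ pr) p‖ = ‖grad n f (pr p)‖ := by
  have hd : ∀ v, inner ℝ (grad m (f ∘ pr) p) v =
      inner ℝ (grad n f (pr p)) (mfderiv (𝓡 m) (𝓡 n) pr p v) := fun v ↦ by
    rw [inner_grad, inner_grad, mvfderiv_comp_apply ((hf _).mdifferentiableAt (by simp))
      ((hpr.smooth p).mdifferentiableAt (by simp))]
  have hgrad : mfderiv (𝓡 m) (𝓡 n) pr p (grad m (f ∘ pr) p) = grad n f (pr p) := by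
    refine ext_inner_right ℝ fun y ↦ ?_
    obtain ⟨z, hz, rfl⟩ := hpr.exists_horizontal_lift p y
    rw [hpr.inner_mfderiv_mfderiv _ hz, hd]
  -- It remains to see that the gradient upstairs is horizontal, which holds since `f ∘ pr` has zero
  -- derivative along the fibres.
  rw [← hgrad, hpr.isometric p]
  intro v hv
  rw [real_inner_comm, hd, show mfderiv (𝓡 m) (𝓡 n) pr p v = 0 from hv, inner_zero_right]

omit [IsManifold (𝓡 m) ∞ E] [IsManifold (𝓡 n) ∞ B] in
theorem focalVarieties_comp (hpr : IsRiemannianSubmersion m n pr)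
    (hf : ContMDiff (𝓡 n) 𝓘(ℝ, ℝ) ∞ f) :
    focalVarieties m (f ∘ pr) = pr ⁻¹' focalVarieties n f := by
  ext p
  simp only [focalVarieties, mem_ofPred_eq, mem_preimage]
  rw [← norm_eq_zero, hpr.norm_grad_comp hf, norm_eq_zero]

omit [IsManifold (𝓡 m) ∞ E] [IsManifold (𝓡 n) ∞ B] in
theorem isTransnormalWith_comp (hpr : IsRiemannianSubmersion m n pr) {b : ℝ → ℝ}
    (hf : IsTransnormalWith n f b) : IsTransnormalWith m (f ∘ pr) b where
  smooth := hf.smooth.comp hpr.smooth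
  nonconstant := by
    obtain ⟨x, y, hxy⟩ := hf.nonconstant
    obtain ⟨p, rfl⟩ := hpr.surjective x
    obtain ⟨q, rfl⟩ := hpr.surjective y
    exact ⟨p, q, hxy⟩
  smooth_b := hf.smooth_b
  norm_grad p := by rw [hpr.norm_grad_comp hf.smooth, hf.norm_grad, Function.comp_apply]

end IsRiemannianSubmersion

omit [IsManifold (𝓡 m) ∞ E] [IsManifold (𝓡 n) ∞ B]
  [RiemannianBundle (fun x : E ↦ TangentSpace (𝓡 m) x)]
  [RiemannianBundle (fun x : B ↦ TangentSpace (𝓡 n) x)] in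
-- Composing a local defining map `g` with the submersion gives a defining map with surjective
-- differential and the same target dimension `k`.
theorem IsSubmanifoldCodimGeTwo.preimage (hpr : ContMDiff (𝓡 m) (𝓡 n) ∞ pr)
    (hs : ∀ p, Function.Surjective (mfderiv (𝓡 m) (𝓡 n) pr p)) {C : Set B}
    (hC : IsSubmanifoldCodimGeTwo n C) : IsSubmanifoldCodimGeTwo m (pr ⁻¹' C) := by
  intro p hp
  obtain ⟨k, hk, U, hU, hpU, g, hg, hgs, hCU⟩ := hC (pr p) hp
  refine ⟨k, hk, pr ⁻¹' U, hU.preimage hpr.continuous, hpU, g ∘ pr,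
    hg.comp hpr.contMDiffOn fun _ h ↦ h, fun q hq ↦ ?_, ?_⟩
  · rw [mfderiv_comp q ((hg.contMDiffAt (hU.mem_nhds hq)).mdifferentiableAt (by simp))
      ((hpr q).mdifferentiableAt (by simp))]
    exact (hgs _ hq).comp (hs q)
  · rw [← preimage_inter, hCU]
    rfl

end Isoparametric

end RiemGeom

end

theorem mainTheorem6 {m n : ℕ}
    {E : Type*} [TopologicalSpace E] [T2Space E] [SecondCountableTopology E]
    [ChartedSpace (EuclideanSpace ℝ (Fin m)) E] [IsManifold (𝓡 m) ∞ E]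
    [RiemannianBundle (fun x : E ↦ TangentSpace (𝓡 m) x)]
    [IsContMDiffRiemannianBundle (𝓡 m) ∞ (EuclideanSpace ℝ (Fin m))
      (fun x : E ↦ TangentSpace (𝓡 m) x)]
    {B : Type*} [TopologicalSpace B] [T2Space B] [SecondCountableTopology B]
    [ChartedSpace (EuclideanSpace ℝ (Fin n)) B] [IsManifold (𝓡 n) ∞ B]
    [RiemannianBundle (fun x : B ↦ TangentSpace (𝓡 n) x)]
    [IsContMDiffRiemannianBundle (𝓡 n) ∞ (EuclideanSpace ℝ (Fin n))
      (fun x : B ↦ TangentSpace (𝓡 n) x)]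
    (pr : E → B) (hpr : RiemGeom.IsRiemannianSubmersion m n pr)
    (hmin : RiemGeom.HasMinimalFibres m n pr) (f : B → ℝ) :
    (RiemGeom.IsIsoparametric n f → RiemGeom.IsIsoparametric m (f ∘ pr)) ∧
      (RiemGeom.IsProperlyIsoparametric n f → RiemGeom.IsProperlyIsoparametric m (f ∘ pr)) := by
  have hiso : RiemGeom.IsIsoparametric n f → RiemGeom.IsIsoparametric m (f ∘ pr) := by
    rintro ⟨⟨b, hb⟩, a, ha, hfa⟩
    refine ⟨⟨b, hpr.isTransnormalWith_comp hb⟩, a, ha, fun p ↦ ?_⟩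
    rw [hpr.laplacian_comp hmin hb.smooth, hfa, Function.comp_apply]
  refine ⟨hiso, fun ⟨hf, hC⟩ ↦ ⟨hiso hf, ?_⟩⟩
  obtain ⟨b, hb⟩ := hf.1
  rw [hpr.focalVarieties_comp hb.smooth]
  exact hC.preimage hpr.smooth hpr.surjective_mfderiv
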